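/- Let $p$ be a prime and let $G$ be a torsion-free abelian group of finite rank (that is, the maximal linearly independent subsets of $G$ over $\mathbb{Z}$ are finite). For an abelian group $A$ write $A^{*p}=\mathrm{Hom}(A,\mathbb{Z}_p)$ for the group of all additive maps $A\to\mathbb{Z}_p$, and let $G^{*p*p}=(G^{*p})^{*p}$; for $g\in G$ let $\hat g\in G^{*p*p}$ be the map $\hat g(\varphi)=\varphi(g)$. Give $G^{*p*p}$ the topology of pointwise convergence on $G^{*p}$ (with the usual topology on $\mathbb{Z}_p$). Let $D$ be the largest divisible subgroup of $G\otimes_{\mathbb{Z}}\mathbb{Z}_p$, and give $Q=(G\otimes_{\mathbb{Z}}\mathbb{Z}_p)/D$ the $p$-adic topology, in which the subgroups $p^nQ$ $(n\ge 0)$ form a basis of neighbourhoods of $0$. Then there is a group isomorphism $e:G^{*p*p}\to Q$, continuous and with continuous inverse, such that $$e(\hat g)=g\otimes 1+D\qquad\text{for all } g\in G .$$ -/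

import Mathlib

open scoped TensorProduct Topology

/-- The group `G^{*p} = Hom(G, ℤ_p)` of `p`-adic functionals on an abelian group `G`. -/
abbrev PadicDual (p : ℕ) [Fact p.Prime] (G : Type*) [AddCommGroup G] : Type _ :=
  G →+ ℤ_[p]

/-- The `p`-adic double dual `G^{*p*p} = Hom(Hom(G, ℤ_p), ℤ_p)`. All additive maps are allowed;
an additive map from a `ℤ_p`-module to `ℤ_p` is automatically `ℤ_p`-linear, and it is automatically
continuous for the `p`-adic topology on its domain. -/
abbrev PadicDoubleDual (p : ℕ) [Fact p.Prime] (G : Type*) [AddCommGroup G] : Type _ :=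
  PadicDual p (PadicDual p G)

/-- The natural homomorphism `g ↦ ĝ` from `G` to `G^{*p*p}`, where `ĝ(φ) = φ(g)`. -/
noncomputable def padicHat (p : ℕ) [Fact p.Prime] (G : Type*) [AddCommGroup G] :
    G →+ PadicDoubleDual p G :=
  AddMonoidHom.eval

/-- The topology of `G^{*p*p}` as a profinite group: pointwise convergence on `G^{*p}`, that is,
the subspace topology from the product of copies of `ℤ_p` indexed by `G^{*p}`. -/
@[reducible]
noncomputable def padicDoubleDualTopology (p : ℕ) [Fact p.Prime] (G : Type*) [AddCommGroup G] :
    TopologicalSpace (PadicDoubleDual p G) :=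
  TopologicalSpace.induced (fun (ψ : PadicDoubleDual p G) (φ : PadicDual p G) => ψ φ)
    inferInstance

/-- The `p`-adic topology on an abelian group `A`: the subgroups `p ^ n A` form a basis of
neighbourhoods of `0`. -/
@[reducible]
noncomputable def padicGroupTopology (p : ℕ) (A : Type*) [AddCommGroup A] : TopologicalSpace A :=
  (Ideal.span {(p : ℤ)}).adicModuleTopology A

/-- The divisible subgroup of an abelian group `A`: the largest divisible subgroup of `A`, which is
the join of all subgroups of `A` that are divisible as abelian groups. -/
def divisibleSubgroup (A : Type*) [AddCommGroup A] : AddSubgroup A :=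
  sSup {H : AddSubgroup A | ∀ n : ℕ, n ≠ 0 → ∀ x ∈ H, ∃ y ∈ H, n • y = x}

/-!
The extension of scalars `M = ℤ_p ⊗ G` has `M / pM` finite, because `G / pG` is: elements of `G`
that are linearly independent modulo `p` are linearly independent over `ℤ`. Since `ℤ_p` is
`p`-adically complete, the largest `p`-adically Hausdorff quotient `N = M / ⋂ pⁿM` is then finitely
generated, and it is torsion-free, hence free and reflexive. As `ℤ_p` is Hausdorff, `M` and `N` have
the same dual, so `M → M**` is `M → N ≃ N**`: it is surjective with kernel `⋂ pⁿM`, which is the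
divisible subgroup of `M`. Additive maps into a `p`-adically Hausdorff module are `ℤ_p`-linear, and
therefore `M**` is `G^{*p*p}`. Finally `G^{*p}` is finitely generated over `ℤ_p`, so pointwise
convergence on it is the `p`-adic topology, for which every additive map is continuous.
-/

section Hausdorffification

open Module

variable {R : Type*} [CommRing R]

theorem mem_span_singleton_pow_smul_top_iff {M : Type*} [AddCommGroup M] [Module R M] {r : R}
    {n : ℕ} {x : M} :
    x ∈ (Ideal.span {r} ^ n • ⊤ : Submodule R M) ↔ ∃ y, r ^ n • y = x := by
  simp [Ideal.span_singleton_pow, Submodule.ideal_span_singleton_smul,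
    Submodule.mem_smul_pointwise_iff_exists]

theorem hausdorffification_of_eq_zero_iff {M : Type*} [AddCommGroup M] [Module R M] {r : R}
    {x : M} : Hausdorffification.of (Ideal.span {r}) M x = 0 ↔ ∀ n : ℕ, ∃ y, r ^ n • y = x := by
  simp only [Hausdorffification.of, Submodule.mkQ_apply, Submodule.Quotient.mk_eq_zero,
    Submodule.mem_iInf, mem_span_singleton_pow_smul_top_iff]

theorem isSMulRegular_hausdorffification {M : Type*} [AddCommGroup M] [Module R M] {r : R}
    (hr : IsSMulRegular M r) : IsSMulRegular (Hausdorffification (Ideal.span {r}) M) r := by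
  refine isSMulRegular_iff_right_eq_zero_of_smul.mpr fun q hq ↦ ?_
  induction q using Hausdorffification.induction_on with | ih x
  rw [← map_smul, hausdorffification_of_eq_zero_iff] at hq
  refine hausdorffification_of_eq_zero_iff.mpr fun n ↦ ?_
  obtain ⟨y, hy⟩ := hq (n + 1)
  exact ⟨y, hr (by change r • r ^ n • y = r • x; rwa [smul_smul, ← pow_succ'])⟩

theorem isPrecomplete_pi {ι : Type*} [Finite ι] (I : Ideal R) (M : ι → Type*)
    [∀ i, AddCommGroup (M i)] [∀ i, Module R (M i)] [∀ i, IsPrecomplete I (M i)] :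
    IsPrecomplete I (∀ i, M i) := by
  classical
  have := Fintype.ofFinite ι
  refine AdicCompletion.of_surjective_iff.mp fun x ↦ ?_
  choose L hL using fun i ↦
    AdicCompletion.of_surjective I (M i) (AdicCompletion.piEquivOfFintype I M x i)
  refine ⟨L, (AdicCompletion.piEquivOfFintype I M).injective (funext fun i ↦ ?_)⟩
  rw [← hL, AdicCompletion.piEquivOfFintype_apply]
  exact AdicCompletion.map_of I _ L

theorem finite_hausdorffification (I : Ideal R) (M : Type*) [AddCommGroup M] [Module R M]
    [IsPrecomplete I R] [Module.Finite R (M ⧸ (I • ⊤ : Submodule R M))] :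
    Module.Finite R (Hausdorffification I M) := by
  obtain ⟨n, f, hf⟩ := Module.Finite.exists_fin' R (M ⧸ (I • ⊤ : Submodule R M))
  obtain ⟨g, hg⟩ := Module.projective_lifting_property _ f (Submodule.mkQ_surjective (I • ⊤))
  have := isPrecomplete_pi I fun _ : Fin n ↦ R
  refine .of_surjective (Hausdorffification.of I M ∘ₗ g)
    (surjective_of_mkQ_comp_surjective (I := I) fun q ↦ ?_)
  obtain ⟨q, rfl⟩ := Submodule.mkQ_surjective _ q
  induction q using Hausdorffification.induction_on with | ih x
  obtain ⟨c, hc⟩ := hf (Submodule.mkQ _ x)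
  have hmem : g c - x ∈ (I • ⊤ : Submodule R M) :=
    (Submodule.Quotient.eq _).mp ((LinearMap.congr_fun hg c).trans hc)
  have hmap : Hausdorffification.of I M (g c - x) ∈
      (I • ⊤ : Submodule R M).map (Hausdorffification.of I M) := Submodule.mem_map_of_mem hmem
  rw [Submodule.map_smul'', map_sub] at hmap
  exact ⟨c, (Submodule.Quotient.eq _).mpr (Submodule.smul_mono le_rfl le_top hmap)⟩

/-- The dual of a module agrees with the dual of its largest `I`-adically Hausdorff quotient,
because the ring of scalars is itself `I`-adically Hausdorff. -/
noncomputable def hausdorffificationDualEquiv (I : Ideal R) [IsHausdorff I R] (M : Type*)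
    [AddCommGroup M] [Module R M] : Dual R (Hausdorffification I M) ≃ₗ[R] Dual R M :=
  { (Hausdorffification.of I M).dualMap with
    invFun := Hausdorffification.lift I
    left_inv := fun f ↦ (Hausdorffification.lift_eq I _ f rfl).symm
    right_inv := Hausdorffification.lift_comp_of I }

theorem dual_eval_eq_comp_hausdorffification_of (I : Ideal R) [IsHausdorff I R] (M : Type*)
    [AddCommGroup M] [Module R M] :
    Dual.eval R M = (hausdorffificationDualEquiv I M).symm.dualMap.toLinearMap ∘ₗ
      Dual.eval R (Hausdorffification I M) ∘ₗ Hausdorffification.of I M :=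
  rfl

theorem ker_dual_eval_eq_ker_hausdorffification_of (I : Ideal R) [IsHausdorff I R] (M : Type*)
    [AddCommGroup M] [Module R M] [IsReflexive R (Hausdorffification I M)] :
    (Dual.eval R M).ker = (Hausdorffification.of I M).ker := by
  rw [dual_eval_eq_comp_hausdorffification_of I M, LinearEquiv.ker_comp,
    LinearMap.ker_comp_of_ker_eq_bot _
      (LinearMap.ker_eq_bot.mpr (bijective_dual_eval R _).injective)]

theorem dual_eval_surjective_of_isReflexive_hausdorffification (I : Ideal R) [IsHausdorff I R]
    (M : Type*) [AddCommGroup M] [Module R M] [IsReflexive R (Hausdorffification I M)] :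
    Function.Surjective (Dual.eval R M) := by
  rw [dual_eval_eq_comp_hausdorffification_of I M, LinearMap.coe_comp, LinearMap.coe_comp]
  exact (LinearEquiv.surjective _).comp <|
    (bijective_dual_eval R (Hausdorffification I M)).surjective.comp (Submodule.mkQ_surjective _)

end Hausdorffification

theorem isTorsionFree_of_isSMulRegular_irreducible {R M : Type*} [CommRing R] [IsDomain R]
    [IsDiscreteValuationRing R] [AddCommGroup M] [Module R M] {ϖ : R} (hϖ : Irreducible ϖ)
    (hM : IsSMulRegular M ϖ) : Module.IsTorsionFree R M := by
  refine .of_smul_eq_zero fun a x h ↦ or_iff_not_imp_left.mpr fun ha ↦ ?_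
  obtain ⟨k, u, rfl⟩ := IsDiscreteValuationRing.eq_unit_mul_pow_irreducible ha hϖ
  rw [mul_smul, ← Units.smul_def, smul_eq_zero_iff_eq] at h
  exact (hM.pow k).right_eq_zero_of_smul h

section ModN

variable {G : Type*} [AddCommGroup G]

theorem linearIndependent_int_of_modN {p : ℕ} [Fact p.Prime] (hp : IsSMulRegular G p) {ι : Type*}
    {v : ι → G} (hv : LinearIndependent (ZMod p) fun i ↦ ModN.mkQ p (v i)) :
    LinearIndependent ℤ v := by
  refine linearIndependent_iff.mpr fun c hc ↦ ?_
  have descent (c : ι →₀ ℤ) (hc : Finsupp.linearCombination ℤ v c = 0) :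
      ∃ d, Finsupp.linearCombination ℤ v d = 0 ∧ c = (p : ℤ) • d := by
    have hsum : ∑ i ∈ c.support, (c i : ZMod p) • ModN.mkQ p (v i) = 0 := by
      simpa only [Int.cast_smul_eq_zsmul, map_sum, map_zsmul, map_zero, Finsupp.sum,
        Finsupp.linearCombination_apply] using congrArg (ModN.mkQ p) hc
    have dvd (i : ι) : (p : ℤ) ∣ c i := by
      by_cases hi : i ∈ c.support
      · exact (ZMod.intCast_zmod_eq_zero_iff_dvd _ p).mp <|
          linearIndependent_iff'.mp hv _ _ hsum i hi
      · exact Finsupp.notMem_support_iff.mp hi ▸ dvd_zero _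
    have hcd : c = (p : ℤ) • c.mapRange (· / (p : ℤ)) (Int.zero_ediv _) :=
      Finsupp.ext fun i ↦ (Int.mul_ediv_cancel' (dvd i)).symm
    refine ⟨_, hp.right_eq_zero_of_smul ?_, hcd⟩
    rwa [← Nat.cast_smul_eq_nsmul ℤ, ← map_smul, ← hcd]
  have exists_eq_pow_smul (n : ℕ) :
      ∃ d, Finsupp.linearCombination ℤ v d = 0 ∧ c = (p : ℤ) ^ n • d := by
    induction n with
    | zero => exact ⟨c, hc, by simp⟩
    | succ n ih =>
      obtain ⟨d, hd, rfl⟩ := ih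
      obtain ⟨e, he, rfl⟩ := descent d hd
      exact ⟨e, he, by rw [pow_succ, mul_smul]⟩
  ext i
  by_contra hi
  have hprime : Prime (p : ℤ) := Nat.prime_iff_prime_int.mp Fact.out
  obtain ⟨n, hn⟩ := FiniteMultiplicity.of_prime_left hprime hi
  obtain ⟨d, -, rfl⟩ := exists_eq_pow_smul (n + 1)
  exact hn (dvd_mul_right _ _)

theorem finite_modN_of_rank_lt_aleph0 {p : ℕ} [Fact p.Prime] (hp : IsSMulRegular G p)
    (hG : Module.rank ℤ G < Cardinal.aleph0) : Finite (ModN G p) := by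
  let b := Module.Free.chooseBasis (ZMod p) (ModN G p)
  obtain ⟨v, hv⟩ := (Submodule.mkQ_surjective
    (LinearMap.range (LinearMap.lsmul ℤ G (p : ℤ)))).comp_left b
  have hli : LinearIndependent ℤ v := linearIndependent_int_of_modN hp <| by
    convert b.linearIndependent using 1
    exact hv
  have := Cardinal.lt_aleph0_iff_finite.mp (hli.cardinal_le_rank.trans_lt hG)
  have := Module.Finite.of_basis b
  exact Module.finite_of_finite (ZMod p)

theorem finite_tensorProduct_quotient_of_modN (R : Type*) [CommRing R] (n : ℕ)
    [Finite (ModN G n)] :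
    Module.Finite R ((R ⊗[ℤ] G) ⧸ (Ideal.span {(n : R)} • ⊤ : Submodule R (R ⊗[ℤ] G))) := by
  let q := Submodule.mkQ (Ideal.span {(n : R)} • ⊤ : Submodule R (R ⊗[ℤ] G))
  let f : G →ₗ[ℤ] (R ⊗[ℤ] G) ⧸ (Ideal.span {(n : R)} • ⊤ : Submodule R (R ⊗[ℤ] G)) :=
    q.restrictScalars ℤ ∘ₗ TensorProduct.mk ℤ R G 1
  have hf : (LinearMap.lsmul ℤ G n).range ≤ f.ker := by
    rintro _ ⟨g, rfl⟩
    rw [LinearMap.mem_ker, LinearMap.lsmul_apply, map_smul, Nat.cast_smul_eq_nsmul,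
      ← Nat.cast_smul_eq_nsmul R]
    exact (Submodule.Quotient.mk_eq_zero _).mpr <|
      Submodule.smul_mem_smul (Ideal.mem_span_singleton_self _) Submodule.mem_top
  let fbar := (LinearMap.range (LinearMap.lsmul ℤ G n)).liftQ f hf
  have hcomp : fbar.liftBaseChange R ∘ₗ (Submodule.mkQ _).baseChange R = q := by
    ext g
    exact LinearMap.liftBaseChange_one_tmul R fbar (Submodule.mkQ _ g)
  have : Module.Finite ℤ (ModN G n) := inferInstance
  refine .of_surjective (fbar.liftBaseChange R) (.of_comp (g := (Submodule.mkQ _).baseChange R) ?_)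
  rw [← LinearMap.coe_comp, hcomp]
  exact Submodule.mkQ_surjective _

end ModN

theorem isSMulRegular_natCast_tensorProduct (R : Type*) [CommRing R] [Module.Flat ℤ R]
    {G : Type*} [AddCommGroup G] {n : ℕ} (hn : IsSMulRegular G n) :
    IsSMulRegular (R ⊗[ℤ] G) (n : R) := by
  have hn' : IsSMulRegular G (n : ℤ) := fun x y hxy ↦
    hn (by simpa only [Nat.cast_smul_eq_nsmul] using hxy)
  exact fun x y hxy ↦ hn'.lTensor R (by simpa only [Nat.cast_smul_eq_nsmul] using hxy)

section PadicModule

open Module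

variable {p : ℕ} [Fact p.Prime]

instance isAdicComplete_span_padicInt : IsAdicComplete (Ideal.span {(p : ℤ_[p])}) ℤ_[p] :=
  PadicInt.maximalIdeal_eq_span_p (p := p) ▸ inferInstance

theorem map_padicInt_smul {A B : Type*} [AddCommGroup A] [Module ℤ_[p] A] [AddCommGroup B]
    [Module ℤ_[p] B] [IsHausdorff (Ideal.span {(p : ℤ_[p])}) B] (f : A →+ B) (a : ℤ_[p]) (x : A) :
    f (a • x) = a • f x := by
  rw [← sub_eq_zero]
  refine IsHausdorff.haus (I := Ideal.span {(p : ℤ_[p])}) inferInstance _ fun n ↦ ?_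
  rw [SModEq.zero, mem_span_singleton_pow_smul_top_iff]
  obtain ⟨k, b, rfl⟩ : ∃ (k : ℕ) (b : ℤ_[p]), a = k + (p ^ n : ℕ) * b := by
    obtain ⟨b, hb⟩ := Ideal.mem_span_singleton.mp (a.appr_spec n)
    exact ⟨a.appr n, b, by rw [Nat.cast_pow, ← hb, add_sub_cancel]⟩
  refine ⟨f (b • x) - b • f x, ?_⟩
  simp only [add_smul, mul_smul, Nat.cast_smul_eq_nsmul, map_add, map_nsmul,
    add_sub_add_left_eq_sub, ← smul_sub, ← Nat.cast_pow]

/-- Every additive map from a `ℤ_p`-module to `ℤ_p` is `ℤ_p`-linear, so that the module dual is the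
group of additive functionals. -/
noncomputable def dualAddEquivPadicDual (A : Type*) [AddCommGroup A] [Module ℤ_[p] A] :
    Dual ℤ_[p] A ≃+ PadicDual p A where
  toFun := LinearMap.toAddMonoidHom
  invFun f := { f with map_smul' := map_padicInt_smul f }
  map_add' _ _ := rfl

theorem map_mem_divisibleSubgroup {A B : Type*} [AddCommGroup A] [AddCommGroup B] (f : A →+ B)
    {x : A} (hx : x ∈ divisibleSubgroup A) : f x ∈ divisibleSubgroup B := by
  have hle : divisibleSubgroup A ≤ (divisibleSubgroup B).comap f := by
    refine sSup_le fun H hH ↦ AddSubgroup.map_le_iff_le_comap.mp (le_sSup ?_)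
    rintro n hn _ ⟨x, hx, rfl⟩
    obtain ⟨y, hy, rfl⟩ := hH n hn x hx
    exact ⟨f y, AddSubgroup.mem_map_of_mem f hy, (map_nsmul f n y).symm⟩
  exact hle hx

theorem map_mem_divisibleSubgroup_iff {A B : Type*} [AddCommGroup A] [AddCommGroup B] (e : A ≃+ B)
    {x : A} : e x ∈ divisibleSubgroup B ↔ x ∈ divisibleSubgroup A :=
  ⟨fun h ↦ e.symm_apply_apply x ▸ map_mem_divisibleSubgroup e.symm.toAddMonoidHom h,
    map_mem_divisibleSubgroup e.toAddMonoidHom⟩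

theorem mem_divisibleSubgroup_iff_hausdorffification_of_eq_zero {M : Type*} [AddCommGroup M]
    [Module ℤ_[p] M] (hM : IsSMulRegular M (p : ℤ_[p])) {x : M} :
    x ∈ divisibleSubgroup M ↔ Hausdorffification.of (Ideal.span {(p : ℤ_[p])}) M x = 0 := by
  let I := Ideal.span {(p : ℤ_[p])}
  suffices divisibleSubgroup M = (Hausdorffification.of I M).ker.toAddSubgroup from
    SetLike.ext_iff.mp this x
  have := isTorsionFree_of_isSMulRegular_irreducible PadicInt.irreducible_p
    (isSMulRegular_hausdorffification hM)
  refine le_antisymm (sSup_le fun H hH x hx ↦ ?_) (le_sSup fun n hn x hx ↦ ?_)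
  · refine hausdorffification_of_eq_zero_iff.mpr fun n ↦ ?_
    obtain ⟨y, -, hy⟩ := hH (p ^ n) (pow_ne_zero n (Fact.out : p.Prime).ne_zero) x hx
    exact ⟨y, by rwa [← Nat.cast_pow, Nat.cast_smul_eq_nsmul]⟩
  · have hn' : (n : ℤ_[p]) ≠ 0 := Nat.cast_ne_zero.mpr hn
    obtain ⟨k, u, hu⟩ :=
      IsDiscreteValuationRing.eq_unit_mul_pow_irreducible hn' PadicInt.irreducible_p
    obtain ⟨y, hy⟩ := hausdorffification_of_eq_zero_iff.mp hx k
    have hny : n • (↑u⁻¹ : ℤ_[p]) • y = x := by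
      rw [← Nat.cast_smul_eq_nsmul ℤ_[p], hu, smul_smul, mul_right_comm, Units.mul_inv, one_mul, hy]
    refine ⟨(↑u⁻¹ : ℤ_[p]) • y, ?_, hny⟩
    have hx' : Hausdorffification.of I M x = 0 := hx
    rw [← hny, map_nsmul, ← Nat.cast_smul_eq_nsmul ℤ_[p]] at hx'
    exact (smul_eq_zero_iff_right hn').mp hx'

end PadicModule

section PadicTopology

variable (p : ℕ)

theorem isTopologicalAddGroup_padicGroupTopology (A : Type*) [AddCommGroup A] :
    @IsTopologicalAddGroup A (padicGroupTopology p A) _ :=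
  AddGroupFilterBasis.isTopologicalAddGroup _

theorem hasBasis_nhds_zero_padicGroupTopology (A : Type*) [AddCommGroup A] :
    (@nhds A (padicGroupTopology p A) 0).HasBasis (fun _ : ℕ ↦ True)
      fun n ↦ {x : A | ∃ y, p ^ n • y = x} := by
  let I := Ideal.span {(p : ℤ)}
  have coe_eq (n : ℕ) : ((I ^ n • ⊤ : Submodule ℤ A) : Set A) = {x | ∃ y, p ^ n • y = x} := by
    ext x
    rw [SetLike.mem_coe, mem_span_singleton_pow_smul_top_iff]
    simp only [← Nat.cast_pow, Nat.cast_smul_eq_nsmul, Set.mem_ofPred_eq]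
  refine ⟨fun U ↦ ?_⟩
  let := I.adic_basis.topology
  refine (I.ringFilterBasis.moduleFilterBasis
    (I.adic_module_basis A)).toAddGroupFilterBasis.nhds_zero_hasBasis.mem_iff.trans ?_
  constructor
  · rintro ⟨_, ⟨n, rfl⟩, hn⟩
    exact ⟨n, trivial, (coe_eq n).symm.trans_subset hn⟩
  · rintro ⟨n, -, hn⟩
    exact ⟨_, ⟨n, rfl⟩, (coe_eq n).trans_subset hn⟩

theorem continuous_padicGroupTopology {A B : Type*} [AddCommGroup A] [AddCommGroup B]
    (f : A →+ B) : Continuous[padicGroupTopology p A, padicGroupTopology p B] f := by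
  let := padicGroupTopology p A
  let := padicGroupTopology p B
  have := isTopologicalAddGroup_padicGroupTopology p A
  have := isTopologicalAddGroup_padicGroupTopology p B
  refine continuous_of_continuousAt_zero f ?_
  rw [ContinuousAt, map_zero, (hasBasis_nhds_zero_padicGroupTopology p A).tendsto_iff
    (hasBasis_nhds_zero_padicGroupTopology p B)]
  refine fun n _ ↦ ⟨n, trivial, ?_⟩
  rintro _ ⟨y, rfl⟩
  exact ⟨f y, (map_nsmul f _ y).symm⟩

variable [Fact p.Prime]

theorem hasBasis_nhds_zero_padicInt :
    (𝓝 (0 : ℤ_[p])).HasBasis (fun _ : ℕ ↦ True) fun n ↦ {x | ∃ y, p ^ n • y = x} := by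
  have hp : (1 : ℝ) < p := Nat.one_lt_cast.mpr (Fact.out : p.Prime).one_lt
  convert Metric.nhds_basis_closedBall_pow (inv_pos.mpr (zero_lt_one.trans hp))
    (inv_lt_one_of_one_lt₀ hp) using 2 with n
  ext x
  rw [mem_closedBall_zero_iff, inv_pow, ← zpow_natCast, ← zpow_neg,
    PadicInt.norm_le_pow_iff_mem_span_pow, Ideal.mem_span_singleton']
  simp only [nsmul_eq_mul, Nat.cast_pow, mul_comm, Set.mem_ofPred_eq]

theorem padicGroupTopology_padicInt :
    padicGroupTopology p ℤ_[p] = (inferInstance : TopologicalSpace ℤ_[p]) :=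
  IsTopologicalAddGroup.ext (isTopologicalAddGroup_padicGroupTopology p _) inferInstance <|
    (hasBasis_nhds_zero_padicGroupTopology p _).eq_of_same_basis (hasBasis_nhds_zero_padicInt p)

theorem exists_nsmul_eq_of_forall_exists_nsmul_eq {A B : Type*} [AddGroup A] [AddCommGroup B]
    {n : ℕ} (hn : IsSMulRegular B n) {f : A →+ B} (h : ∀ a, ∃ b, n • b = f a) :
    ∃ g : A →+ B, n • g = f := by
  choose g hg using h
  exact ⟨.mk' g fun x y ↦ hn (by simp [hg]), AddMonoidHom.ext hg⟩

theorem exists_pow_nsmul_eq_of_span_eq_top {A : Type*} [AddCommGroup A] [Module ℤ_[p] A]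
    {s : Set A} (hs : Submodule.span ℤ_[p] s = ⊤) {n : ℕ} {ψ : PadicDual p A}
    (h : ∀ a ∈ s, ∃ c, p ^ n • c = ψ a) : ∃ χ : PadicDual p A, p ^ n • χ = ψ := by
  refine exists_nsmul_eq_of_forall_exists_nsmul_eq ?_ fun a ↦ ?_
  · exact fun x y hxy ↦ smul_right_injective _ (pow_ne_zero n (Fact.out : p.Prime).ne_zero) hxy
  · induction hs ▸ Submodule.mem_top (x := a) using Submodule.span_induction with
    | mem a ha => exact h a ha
    | zero => exact ⟨0, by simp⟩
    | add a b _ _ ha hb =>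
      obtain ⟨c, hc⟩ := ha
      obtain ⟨d, hd⟩ := hb
      exact ⟨c + d, by rw [smul_add, hc, hd, map_add]⟩
    | smul r a _ ha =>
      obtain ⟨c, hc⟩ := ha
      exact ⟨r • c, by rw [smul_comm, hc, map_padicInt_smul]⟩

theorem induced_coe_eq_padicGroupTopology (A : Type*) [AddCommGroup A] [Module ℤ_[p] A]
    [Module.Finite ℤ_[p] A] :
    TopologicalSpace.induced (fun (ψ : PadicDual p A) (a : A) ↦ ψ a) inferInstance =
      padicGroupTopology p (PadicDual p A) := by
  let t := TopologicalSpace.induced (fun (ψ : PadicDual p A) (a : A) ↦ ψ a) inferInstance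
  have hle : padicGroupTopology p (PadicDual p A) ≤ t := by
    rw [← continuous_iff_le_induced]
    let := padicGroupTopology p (PadicDual p A)
    refine continuous_pi fun a ↦ ?_
    have heval := continuous_padicGroupTopology p (AddMonoidHom.eval a : PadicDual p A →+ ℤ_[p])
    rwa [padicGroupTopology_padicInt] at heval
  refine IsTopologicalAddGroup.ext (topologicalAddGroup_induced (AddMonoidHom.coeFn A ℤ_[p]))
    (isTopologicalAddGroup_padicGroupTopology p _) (le_antisymm ?_ (nhds_mono hle))
  obtain ⟨s, hs⟩ := Module.Finite.fg_top (R := ℤ_[p]) (M := A)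
  refine (hasBasis_nhds_zero_padicGroupTopology p _).ge_iff.mpr fun n _ ↦ ?_
  have eventually_dvd (a : A) : ∀ᶠ ψ : PadicDual p A in 𝓝 0, ∃ c, p ^ n • c = ψ a := by
    have heval : Continuous fun ψ : PadicDual p A ↦ ψ a :=
      (continuous_apply a).comp continuous_induced_dom
    exact heval.tendsto' 0 0 rfl ((hasBasis_nhds_zero_padicInt p).mem_of_mem trivial)
  filter_upwards [(Filter.eventually_all_finset s).mpr fun a _ ↦ eventually_dvd a] with ψ hψ
  exact exists_pow_nsmul_eq_of_span_eq_top p hs hψ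

end PadicTopology

section DoubleDual

open Module

variable (p : ℕ) [Fact p.Prime] (G : Type*) [AddCommGroup G]

/-- `Hom(G, ℤ_p)` is the `ℤ_p`-dual of the extension of scalars `ℤ_p ⊗ G`. -/
noncomputable def padicDualEquivDual : PadicDual p G ≃ₗ[ℤ_[p]] Dual ℤ_[p] (ℤ_[p] ⊗[ℤ] G) :=
  addMonoidHomLequivInt ℤ_[p] ≪≫ₗ LinearMap.liftBaseChangeEquiv ℤ_[p]

/-- `G^{*p*p}` is the `ℤ_p`-bidual of the extension of scalars `ℤ_p ⊗ G`. -/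
noncomputable def bidualEquivPadicDoubleDual :
    Dual ℤ_[p] (Dual ℤ_[p] (ℤ_[p] ⊗[ℤ] G)) ≃+ PadicDoubleDual p G :=
  (padicDualEquivDual p G).dualMap.toAddEquiv.trans (dualAddEquivPadicDual (PadicDual p G))

/-- The `ℤ_p`-linear extension of `g ↦ ĝ` to `G ⊗ ℤ_p`. -/
noncomputable def padicEval : G ⊗[ℤ] ℤ_[p] →+ PadicDoubleDual p G :=
  (bidualEquivPadicDoubleDual p G).toAddMonoidHom.comp <|
    (Dual.eval ℤ_[p] (ℤ_[p] ⊗[ℤ] G)).toAddMonoidHom.comp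
      (TensorProduct.comm ℤ G ℤ_[p]).toAddEquiv.toAddMonoidHom

theorem padicEval_tmul_one (g : G) : padicEval p G (g ⊗ₜ 1) = padicHat p G g :=
  AddMonoidHom.ext fun φ ↦ LinearMap.liftBaseChange_one_tmul ℤ_[p] φ.toIntLinearMap g

theorem finite_padicDual [Finite (ModN G p)] : Module.Finite ℤ_[p] (PadicDual p G) := by
  have := finite_tensorProduct_quotient_of_modN (G := G) ℤ_[p] p
  have := finite_hausdorffification (Ideal.span {(p : ℤ_[p])}) (ℤ_[p] ⊗[ℤ] G)
  exact .equiv ((hausdorffificationDualEquiv (Ideal.span {(p : ℤ_[p])}) _).trans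
    (padicDualEquivDual p G).symm)

variable {p G}

theorem isReflexive_hausdorffification_tensorProduct (hp : IsSMulRegular G p) [Finite (ModN G p)] :
    IsReflexive ℤ_[p] (Hausdorffification (Ideal.span {(p : ℤ_[p])}) (ℤ_[p] ⊗[ℤ] G)) := by
  have := finite_tensorProduct_quotient_of_modN (G := G) ℤ_[p] p
  have := finite_hausdorffification (Ideal.span {(p : ℤ_[p])}) (ℤ_[p] ⊗[ℤ] G)
  have := isTorsionFree_of_isSMulRegular_irreducible PadicInt.irreducible_p
    (isSMulRegular_hausdorffification (isSMulRegular_natCast_tensorProduct ℤ_[p] hp))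
  infer_instance

theorem padicEval_surjective (hp : IsSMulRegular G p) [Finite (ModN G p)] :
    Function.Surjective (padicEval p G) := by
  have := isReflexive_hausdorffification_tensorProduct hp
  exact (bidualEquivPadicDoubleDual p G).surjective.comp <|
    (dual_eval_surjective_of_isReflexive_hausdorffification (Ideal.span {(p : ℤ_[p])}) _).comp
      (TensorProduct.comm ℤ G ℤ_[p]).surjective

theorem ker_padicEval (hp : IsSMulRegular G p) [Finite (ModN G p)] :
    (padicEval p G).ker = divisibleSubgroup (G ⊗[ℤ] ℤ_[p]) := by
  have := isReflexive_hausdorffification_tensorProduct hp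
  ext x
  calc padicEval p G x = 0 ↔ Dual.eval ℤ_[p] _ (TensorProduct.comm ℤ G ℤ_[p] x) = 0 :=
        (bidualEquivPadicDoubleDual p G).map_eq_zero_iff
    _ ↔ Hausdorffification.of (Ideal.span {(p : ℤ_[p])}) _ (TensorProduct.comm ℤ G ℤ_[p] x) = 0 :=
        SetLike.ext_iff.mp (ker_dual_eval_eq_ker_hausdorffification_of _ _) _
    _ ↔ TensorProduct.comm ℤ G ℤ_[p] x ∈ divisibleSubgroup _ :=
        (mem_divisibleSubgroup_iff_hausdorffification_of_eq_zero
          (isSMulRegular_natCast_tensorProduct ℤ_[p] hp)).symm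
    _ ↔ x ∈ divisibleSubgroup _ :=
        map_mem_divisibleSubgroup_iff (TensorProduct.comm ℤ G ℤ_[p]).toAddEquiv

end DoubleDual

theorem theorem3p1_general (p : ℕ) [Fact p.Prime] (G : Type*) [AddCommGroup G]
    (hp : IsSMulRegular G p) [Finite (ModN G p)] :
    ∃ e : PadicDoubleDual p G ≃+ (G ⊗[ℤ] ℤ_[p]) ⧸ divisibleSubgroup (G ⊗[ℤ] ℤ_[p]),
      Continuous[padicDoubleDualTopology p G,
        padicGroupTopology p ((G ⊗[ℤ] ℤ_[p]) ⧸ divisibleSubgroup (G ⊗[ℤ] ℤ_[p]))] e ∧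
      Continuous[padicGroupTopology p ((G ⊗[ℤ] ℤ_[p]) ⧸ divisibleSubgroup (G ⊗[ℤ] ℤ_[p])),
        padicDoubleDualTopology p G] e.symm ∧
      ∀ g : G, e (padicHat p G g) =
        QuotientAddGroup.mk' (divisibleSubgroup (G ⊗[ℤ] ℤ_[p])) (g ⊗ₜ[ℤ] (1 : ℤ_[p])) := by
  have := finite_padicDual p G
  let e := ((QuotientAddGroup.quotientAddEquivOfEq (ker_padicEval hp).symm).trans
    (QuotientAddGroup.quotientKerEquivOfSurjective _ (padicEval_surjective hp))).symm
  have he (x : G ⊗[ℤ] ℤ_[p]) : e (padicEval p G x) = QuotientAddGroup.mk' _ x :=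
    (AddEquiv.eq_symm_apply e).mp rfl
  have htop : padicDoubleDualTopology p G = padicGroupTopology p (PadicDoubleDual p G) :=
    induced_coe_eq_padicGroupTopology p (PadicDual p G)
  rw [htop]
  exact ⟨e, continuous_padicGroupTopology p e.toAddMonoidHom,
    continuous_padicGroupTopology p e.symm.toAddMonoidHom,
    fun g ↦ by rw [← padicEval_tmul_one, he]⟩

theorem theorem3p1 (p : ℕ) [Fact p.Prime] (G : Type*) [AddCommGroup G] [IsAddTorsionFree G]
    (hG : Module.rank ℤ G < Cardinal.aleph0) :
    ∃ e : PadicDoubleDual p G ≃+ (G ⊗[ℤ] ℤ_[p]) ⧸ divisibleSubgroup (G ⊗[ℤ] ℤ_[p]),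
      Continuous[padicDoubleDualTopology p G,
        padicGroupTopology p ((G ⊗[ℤ] ℤ_[p]) ⧸ divisibleSubgroup (G ⊗[ℤ] ℤ_[p]))] e ∧
      Continuous[padicGroupTopology p ((G ⊗[ℤ] ℤ_[p]) ⧸ divisibleSubgroup (G ⊗[ℤ] ℤ_[p])),
        padicDoubleDualTopology p G] e.symm ∧
      ∀ g : G, e (padicHat p G g) =
        QuotientAddGroup.mk' (divisibleSubgroup (G ⊗[ℤ] ℤ_[p])) (g ⊗ₜ[ℤ] (1 : ℤ_[p])) := by
  have hp : IsSMulRegular G p := nsmul_right_injective (Fact.out : p.Prime).ne_zero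
  have := finite_modN_of_rank_lt_aleph0 hp hG
  exact theorem3p1_general p G hp
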